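/- \textbf{Definitions.} Let $X$ be a metric space; $B_v(r)$ denotes the closed ball of radius $r$ about $v$. For an integer $n\ge 0$, the \emph{asymptotic Assouad--Nagata dimension} of $X$ is at most $n$ if there are constants $c,b\ge 0$ such that for every $m>0$ there is a cover $\mathcal U$ of $X$ by sets of diameter at most $cm+b$ such that every ball of radius $m$ in $X$ meets at most $n+1$ elements of $\mathcal U$; it is \emph{infinite} if it is at most $n$ for no $n$. A $(1,1)$-\emph{net} of $X$ is a set $N\subseteq X$ such that every point of $X$ is at distance at most $1$ from some point of $N$ and any two distinct points of $N$ are at distance at least $1$. The \emph{$1$-growth function} of $X$ is $$\gamma(r)=\sup\{|B_v(r)\cap N| : v\in X,\ N \text{ a } (1,1)\text{-net of } X\}\in\{0,1,2,\dots\}\cup\{\infty\}.$$ A connected graph $G=(V,E)$ is viewed as a geodesic metric space in which every edge has length $1$; its \emph{growth function} is $\gamma(r)=\sup_{v\in V}|B_v(r)\cap V|$. \textbf{Theorem.} (1) There is a metric space $X$ whose $1$-growth function satisfies $$\lim_{r\to\infty}\frac{\gamma(r)}{r}=0$$ and whose asymptotic Assouad--Nagata dimension is infinite. (2) There is a connected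 graph $G=(V,E)$ whose growth function satisfies $$\lim_{r\to\infty}\frac{\gamma(r)}{r^{1+\epsilon}}=0\qquad\text{for every } \epsilon>0$$ and whose asymptotic Assouad--Nagata dimension is infinite. -/

import Mathlib

open Filter Topology
open scoped ENNReal

noncomputable section

namespace CoarseGeometry

/-! ### Asymptotic Assouad–Nagata dimension -/

/-- The `m`-multiplicity of the family `𝒰` is at most `k`: every (closed) ball of radius `m`
meets at most `k` members of `𝒰`. -/
def MultiplicityLE {X : Type*} [PseudoMetricSpace X] (𝒰 : Set (Set X)) (m : ℝ) (k : ℕ) : Prop :=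
  ∀ x : X, {U ∈ 𝒰 | (U ∩ Metric.closedBall x m).Nonempty}.encard ≤ k

/-- All members of `𝒰` have diameter at most `D`. -/
def BoundedBy {X : Type*} [PseudoMetricSpace X] (𝒰 : Set (Set X)) (D : ℝ) : Prop :=
  ∀ U ∈ 𝒰, ∀ x ∈ U, ∀ y ∈ U, dist x y ≤ D

/-- The asymptotic Assouad–Nagata dimension of `X` is at most `n`: there is a linear function
`D m = c * m + b` such that for every `m > 0` the space has a cover by sets of diameter at most
`D m` and of `m`-multiplicity at most `n + 1`. (The additive constant makes this a condition on
large scales only; equivalently, one may require diameters at most `c * m` for all large `m`.) -/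
def AsymptoticANDimLE (X : Type*) [PseudoMetricSpace X] (n : ℕ) : Prop :=
  ∃ c b : ℝ, 0 ≤ c ∧ 0 ≤ b ∧ ∀ m : ℝ, 0 < m →
    ∃ 𝒰 : Set (Set X), ⋃₀ 𝒰 = Set.univ ∧ BoundedBy 𝒰 (c * m + b) ∧ MultiplicityLE 𝒰 m (n + 1)

/-- The asymptotic Assouad–Nagata dimension: the least `n` with `AsymptoticANDimLE X n`, and `⊤`
if there is none. -/
def asymptoticANDim (X : Type*) [PseudoMetricSpace X] : ℕ∞ :=
  ⨅ (n : ℕ) (_ : AsymptoticANDimLE X n), (n : ℕ∞)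

/-! ### Growth of metric spaces -/

/-- `N` is an `(ε, δ)`-net of `X`. -/
def IsNet {X : Type*} [PseudoMetricSpace X] (ε δ : ℝ) (N : Set X) : Prop :=
  (∀ x : X, ∃ a ∈ N, dist x a ≤ ε) ∧ ∀ a ∈ N, ∀ b ∈ N, a ≠ b → δ ≤ dist a b

/-- The `t`-growth function of `X`: the supremum of `|B_v(r) ∩ N|` over all points `v` and all
`(t, t)`-nets `N`. -/
def metricGrowth (X : Type*) [PseudoMetricSpace X] (t r : ℝ) : ℕ∞ :=
  ⨆ (v : X) (N : Set X) (_ : IsNet t t N), (Metric.closedBall v r ∩ N).encard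

/-! ### Graphs as geodesic metric spaces with edges of length one -/

variable {V : Type*}

/-- The closed segment joining the vertices `u` and `v`, in barycentric coordinates. -/
def edgeSegment (u v : V) : Set (V →₀ ℝ) :=
  segment ℝ (Finsupp.single u 1) (Finsupp.single v 1)

/-- The points of the geometric realization of a graph: vertices and points of edges, given by
their barycentric coordinates. -/
def Realization (G : SimpleGraph V) : Type _ :=
  {p : V →₀ ℝ // (∃ u, p = Finsupp.single u 1) ∨ ∃ u v, G.Adj u v ∧ p ∈ edgeSegment u v}

/-- A vertex, as a point of the realization. -/
def vertex (G : SimpleGraph V) (u : V) : Realization G :=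
  ⟨Finsupp.single u 1, Or.inl ⟨u, rfl⟩⟩

/-- `Chain G p q ℓ`: there is a piecewise linear path of length `ℓ` from `p` to `q`, that is, a
finite sequence of points from `p` to `q` in which any two consecutive points lie on a common edge,
and `ℓ` is the sum of the distances of consecutive points measured along these edges (every edge
being isometric to `[0, 1]`). -/
inductive Chain (G : SimpleGraph V) : Realization G → Realization G → ℝ → Prop
  | refl (p : Realization G) : Chain G p p 0
  | step (p q s : Realization G) (u v : V) (ℓ : ℝ) (huv : G.Adj u v)
      (hp : p.1 ∈ edgeSegment u v) (hq : q.1 ∈ edgeSegment u v) (h : Chain G q s ℓ) :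
      Chain G p s (|p.1 u - q.1 u| + ℓ)

/-- The path metric on the realization: the infimum of the lengths of piecewise linear paths. -/
def pathDist (G : SimpleGraph V) (p q : Realization G) : ℝ :=
  sInf {ℓ : ℝ | Chain G p q ℓ}

/-- Barycentric coordinates of a point of an edge. -/
theorem edge_coords {u v : V} (huv : u ≠ v) {p : V →₀ ℝ} (hp : p ∈ edgeSegment u v) :
    p v = 1 - p u ∧ (∀ w, w ≠ u → w ≠ v → p w = 0) ∧
      p = Finsupp.single u (p u) + Finsupp.single v (1 - p u) ∧ 0 ≤ p u ∧ p u ≤ 1 := by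
  classical
  obtain ⟨a, b, ha, hb, hab, rfl⟩ := hp
  have h1 : (a • Finsupp.single u (1 : ℝ) + b • Finsupp.single v (1 : ℝ)) u = a := by
    simp [huv.symm]
  rw [h1]
  refine ⟨?_, ?_, ?_, ha, by linarith⟩
  · simp [huv]; linarith
  · intro w hu hv
    simp [hu.symm, hv.symm]
  · have : 1 - a = b := by linarith
    rw [this]; simp

theorem Chain.nonneg {G : SimpleGraph V} {p q : Realization G} {ℓ : ℝ} (h : Chain G p q ℓ) :
    0 ≤ ℓ := by
  induction h with
  | refl => exact le_rfl
  | step p q s u v ℓ _ _ _ _ ih => positivity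

theorem Chain.trans {G : SimpleGraph V} {p q s : Realization G} {ℓ k : ℝ} (h : Chain G p q ℓ)
    (h' : Chain G q s k) : Chain G p s (ℓ + k) := by
  induction h with
  | refl => simpa using h'
  | step p q _ u v ℓ huv hp hq _ ih =>
    rw [add_assoc]
    exact Chain.step p q s u v _ huv hp hq (ih h')

theorem Chain.single {G : SimpleGraph V} {p q : Realization G} {u v : V} (huv : G.Adj u v)
    (hp : p.1 ∈ edgeSegment u v) (hq : q.1 ∈ edgeSegment u v) :
    Chain G p q |p.1 u - q.1 u| := by
  simpa using Chain.step p q q u v 0 huv hp hq (Chain.refl q)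

theorem Chain.symm {G : SimpleGraph V} {p q : Realization G} {ℓ : ℝ} (h : Chain G p q ℓ) :
    Chain G q p ℓ := by
  induction h with
  | refl p => exact Chain.refl p
  | step p q s u v ℓ huv hp hq _ ih =>
    rw [add_comm, abs_sub_comm]
    exact ih.trans (Chain.single huv hq hp)

theorem Chain.of_walk {G : SimpleGraph V} {u v : V} (w : G.Walk u v) :
    Chain G (vertex G u) (vertex G v) w.length := by
  classical
  induction w with
  | nil => simpa using Chain.refl _
  | @cons a b c h w ih =>
    have := Chain.step (vertex G a) (vertex G b) (vertex G c) a b _ h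
      (left_mem_segment ℝ _ _) (right_mem_segment ℝ _ _) ih
    have e : |(vertex G a).1 a - (vertex G b).1 a| = 1 := by
      simp [vertex, h.ne.symm]
    rw [e] at this
    rw [SimpleGraph.Walk.length_cons]
    push_cast
    rwa [add_comm]

theorem Chain.exists_vertex {G : SimpleGraph V} (p : Realization G) :
    ∃ u ℓ, Chain G p (vertex G u) ℓ := by
  obtain ⟨p, hp⟩ := p
  rcases hp with ⟨u, rfl⟩ | ⟨u, v, huv, hp⟩
  · exact ⟨u, 0, Chain.refl (vertex G u)⟩
  · exact ⟨u, _, Chain.single huv hp (left_mem_segment ℝ _ _)⟩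

theorem Chain.exists_of_connected {G : SimpleGraph V} (hG : G.Connected) (p q : Realization G) :
    ∃ ℓ, Chain G p q ℓ := by
  obtain ⟨u, a, ha⟩ := Chain.exists_vertex p
  obtain ⟨v, b, hb⟩ := Chain.exists_vertex q
  obtain ⟨w⟩ := hG.preconnected u v
  exact ⟨_, (ha.trans (Chain.of_walk w)).trans hb.symm⟩

theorem Chain.lipschitz {G : SimpleGraph V} (f : Realization G → ℝ)
    (hf : ∀ u v p q, G.Adj u v → p.1 ∈ edgeSegment u v → q.1 ∈ edgeSegment u v →
      |f p - f q| ≤ |p.1 u - q.1 u|)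
    {p q : Realization G} {ℓ : ℝ} (h : Chain G p q ℓ) : |f p - f q| ≤ ℓ := by
  induction h with
  | refl => simp
  | step p q s u v ℓ huv hp hq _ ih =>
    exact (abs_sub_le (f p) (f q) (f s)).trans (add_le_add (hf u v p q huv hp hq) ih)

theorem Chain.coord_le {G : SimpleGraph V} {p q : Realization G} {ℓ : ℝ} (h : Chain G p q ℓ)
    (w : V) : |p.1 w - q.1 w| ≤ ℓ := by
  refine Chain.lipschitz (fun p => p.1 w) (fun u v p q huv hp hq => ?_) h
  obtain ⟨hp1, hp2, -⟩ := edge_coords huv.ne hp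
  obtain ⟨hq1, hq2, -⟩ := edge_coords huv.ne hq
  by_cases hu : w = u
  · rw [hu]
  by_cases hv : w = v
  · rw [hv, hp1, hq1, abs_sub_comm]
    apply le_of_eq
    congr 1
    ring
  · simp [hp2 w hu hv, hq2 w hu hv]

theorem bddBelow_chain (G : SimpleGraph V) (p q : Realization G) :
    BddBelow {ℓ : ℝ | Chain G p q ℓ} :=
  ⟨0, fun _ h => h.nonneg⟩

/-- A connected graph, viewed as a geodesic metric space whose edges have length one. -/
@[reducible]
def realizationMetricSpace {G : SimpleGraph V} (hG : G.Connected) :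
    MetricSpace (Realization G) where
  dist := pathDist G
  dist_self p := le_antisymm (csInf_le (bddBelow_chain G p p) (Chain.refl p))
    (Real.sInf_nonneg fun _ h => Chain.nonneg h)
  dist_comm p q := by
    show sInf _ = sInf _
    congr 1
    ext ℓ
    exact ⟨Chain.symm, Chain.symm⟩
  dist_triangle p q s := by
    refine le_of_forall_pos_le_add fun ε hε => ?_
    obtain ⟨a, ha, ha'⟩ := Real.lt_sInf_add_pos (Chain.exists_of_connected hG p q) (half_pos hε)
    obtain ⟨b, hb, hb'⟩ := Real.lt_sInf_add_pos (Chain.exists_of_connected hG q s) (half_pos hε)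
    have h1 : pathDist G p s ≤ a + b := csInf_le (bddBelow_chain G p s) (Chain.trans ha hb)
    have h2 : a < pathDist G p q + ε / 2 := ha'
    have h3 : b < pathDist G q s + ε / 2 := hb'
    linarith
  eq_of_dist_eq_zero := by
    intro p q h
    apply Subtype.ext
    ext w
    have h1 : |p.1 w - q.1 w| ≤ pathDist G p q :=
      le_csInf (Chain.exists_of_connected hG p q) fun _ h => Chain.coord_le h w
    have h2 : |p.1 w - q.1 w| ≤ 0 := h1.trans_eq h
    exact sub_eq_zero.mp (abs_nonpos_iff.mp h2)

/-- The distance of two vertices in the realization is the length of a shortest walk. -/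
theorem pathDist_vertex {G : SimpleGraph V} (hG : G.Connected) (u v : V) :
    pathDist G (vertex G u) (vertex G v) = G.dist u v := by
  classical
  apply le_antisymm
  · obtain ⟨w, hw⟩ := hG.exists_walk_length_eq_dist u v
    rw [← hw]
    exact csInf_le (bddBelow_chain G _ _) (Chain.of_walk w)
  · refine le_csInf (Chain.exists_of_connected hG _ _) fun ℓ h => ?_
    have key := Chain.lipschitz (fun p => p.1.sum fun w a => a * (G.dist u w : ℝ))
      (fun a b p q hab hp hq => ?_) h
    · simp [vertex] at key
      exact key
    · have expand : ∀ x : V →₀ ℝ, x ∈ edgeSegment a b →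
          (x.sum fun w t => t * (G.dist u w : ℝ)) =
            x a * (G.dist u a : ℝ) + (1 - x a) * (G.dist u b : ℝ) := by
        intro x hx
        obtain ⟨-, -, h3, -⟩ := edge_coords hab.ne hx
        conv_lhs => rw [h3]
        rw [Finsupp.sum_add_index' (by simp) (by intros; ring)]
        rw [Finsupp.sum_single_index (by simp), Finsupp.sum_single_index (by simp)]
      have hd : |(G.dist u a : ℝ) - G.dist u b| ≤ 1 := by
        have h1 : G.dist u a ≤ G.dist u b + G.dist b a := hG.dist_triangle
        have h2 : G.dist u b ≤ G.dist u a + G.dist a b := hG.dist_triangle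
        rw [SimpleGraph.dist_eq_one_iff_adj.mpr hab.symm] at h1
        rw [SimpleGraph.dist_eq_one_iff_adj.mpr hab] at h2
        have h1' : (G.dist u a : ℝ) ≤ G.dist u b + 1 := by exact_mod_cast h1
        have h2' : (G.dist u b : ℝ) ≤ G.dist u a + 1 := by exact_mod_cast h2
        rw [abs_le]
        constructor <;> linarith
      show |(p.1.sum fun w t => t * (G.dist u w : ℝ)) -
        (q.1.sum fun w t => t * (G.dist u w : ℝ))| ≤ _
      rw [expand _ hp, expand _ hq]
      have : p.1 a * (G.dist u a : ℝ) + (1 - p.1 a) * (G.dist u b : ℝ) -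
          (q.1 a * (G.dist u a : ℝ) + (1 - q.1 a) * (G.dist u b : ℝ)) =
          (p.1 a - q.1 a) * ((G.dist u a : ℝ) - G.dist u b) := by ring
      rw [this, abs_mul]
      exact mul_le_of_le_one_right (abs_nonneg _) hd

/-- The asymptotic Assouad–Nagata dimension of a connected graph, viewed as a geodesic metric
space whose edges have length one. -/
def graphAsymptoticANDim {G : SimpleGraph V} (hG : G.Connected) : ℕ∞ :=
  letI := realizationMetricSpace hG
  asymptoticANDim (Realization G)

/-- The (uniform) growth function of a connected graph: the supremum over all vertices `v` of the
number of vertices in the ball `B_v(r)`. -/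
def graphGrowth (G : SimpleGraph V) (r : ℝ) : ℕ∞ :=
  ⨆ v : V, {w : V | (G.dist v w : ℝ) ≤ r}.encard

end CoarseGeometry

end

noncomputable section

namespace CoarseGeometry

/-! Infinite dimension needs only one bad scale for each `n`: a coarse `n`-cube of mesh `m` whose
opposite faces are more than `n * m + n` apart. For `n` large compared with `c` and `b`, no set of
diameter `c * m + b` touches opposite faces, so Lebesgue's covering theorem
(`exists_cube_injective_labels`, a determinant count mod 2) gives a ball of radius `m` meeting `n +
1` sets of the cover; this is `asymptoticANDim_eq_top`.

Such cubes cost little growth, because a finite cube can be laid along a line: each point of the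
cube receives a block of the line, and adjacent points are joined by a chord between their blocks,
with at most one chord at each position (`cubeModel`). Opposite faces stay far apart because the
coordinates extend to Lipschitz functions on the line that agree at the two ends of every chord. The
models are stretched by rapidly growing factors `scale p`, the chords keeping length one, and placed
one after another.

Beyond `start P` chord ends are `scale P` apart, so a ball of radius `r < scale P / 2` lies in `[0,
start P + r]` and two intervals of radius `r` (`ball_subset`). As `start (p + 1)` is at most `scale
p` to the power `1 + 1 / (p + 2)`, the graph has growth `r ^ (1 + o(1))`. The cubes consist of
nodes; if only the nodes are kept, a ball has at most `start p + (model p).size + 2` points, which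
is negligible against `scale p`, and the growth becomes sublinear. -/

/-! ### A cubical Sperner lemma -/

/-- The `j`-th vertex of the simplex of the Freudenthal triangulation of the cube `z + [0, 1]ⁿ`
in which the coordinate `i` is raised at time `ρ i`. -/
def simplexVertex {n : ℕ} (z : Fin n → ℕ) (ρ : Equiv.Perm (Fin n)) (j : ℕ) : Fin n → ℕ :=
  fun i => z i + if (ρ i : ℕ) < j then 1 else 0

theorem sum_telescope_coord {m k : ℕ} (i : Fin (m + 1)) (B : (Fin (m + 1) → ℕ) → ZMod 2) :
    ∑ z : Fin (m + 1) → Fin k,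
        (B (fun j => z j + if j = i then 1 else 0) + B (fun j => z j)) =
      ∑ z : Fin m → Fin k,
        (B (i.insertNth k fun j => z j) + B (i.insertNth 0 fun j => z j)) := by
  rw [← (Fin.insertNthEquiv (fun _ => Fin k) i).sum_comp, Fintype.sum_prod_type_right]
  refine Finset.sum_congr rfl fun z _ => ?_
  have h1 : ∀ t : Fin k, (fun j => ((Fin.insertNthEquiv (fun _ => Fin k) i (t, z) j : Fin k) : ℕ))
      = i.insertNth (t : ℕ) fun j => (z j : ℕ) := by
    intro t
    funext j
    refine Fin.succAboveCases i ?_ (fun j => ?_) j <;> simp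
  have h2 : ∀ t : Fin k, (fun j => ((Fin.insertNthEquiv (fun _ => Fin k) i (t, z) j : Fin k) : ℕ)
      + if j = i then 1 else 0) = i.insertNth ((t : ℕ) + 1) fun j => (z j : ℕ) := by
    intro t
    funext j
    refine Fin.succAboveCases i ?_ (fun j => ?_) j <;> simp
  simp only [h1, h2]
  rw [Fin.sum_univ_eq_sum_range (fun t => B (i.insertNth (t + 1) fun j => (z j : ℕ)) +
    B (i.insertNth t fun j => (z j : ℕ))) k]
  have := Finset.sum_range_sub (fun t => B (i.insertNth t fun j => (z j : ℕ))) k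
  simpa only [CharTwo.sub_eq_add] using this

/-- Exchanging two consecutive raises affects only the vertex between them, so the facet opposite to
it is shared by two simplices of the same cube. -/
theorem simplexVertex_swap {m : ℕ} (z : Fin (m + 1) → ℕ) (ρ : Equiv.Perm (Fin (m + 1)))
    (t : Fin m) (l : ℕ) (hl : l ≠ t + 1) :
    simplexVertex z (Equiv.swap t.castSucc t.succ * ρ) l = simplexVertex z ρ l := by
  funext i
  simp only [simplexVertex, Equiv.Perm.mul_apply]
  congr 2
  rcases eq_or_ne (ρ i) t.castSucc with h | h
  · rw [h, Equiv.swap_apply_left]; simp; omega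
  rcases eq_or_ne (ρ i) t.succ with h' | h'
  · rw [h', Equiv.swap_apply_right]; simp; omega
  · rw [Equiv.swap_apply_of_ne_of_ne h h']

/-- The facet of a Freudenthal simplex opposite to its first vertex; `w` is the second vertex. -/
def simplexFacet {m : ℕ} (w : Fin (m + 1) → ℕ) (ρ : Equiv.Perm (Fin (m + 1))) (l : ℕ) :
    Fin (m + 1) → ℕ :=
  fun i => w i + if 0 < (ρ i : ℕ) ∧ (ρ i : ℕ) ≤ l then 1 else 0

theorem simplexVertex_succ {m : ℕ} (z : Fin (m + 1) → ℕ) (ρ : Equiv.Perm (Fin (m + 1))) (l : ℕ) :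
    simplexVertex z ρ (l + 1) =
      simplexFacet (fun j => z j + if j = ρ.symm 0 then 1 else 0) ρ l := by
  funext i
  simp only [simplexVertex, simplexFacet, Equiv.eq_symm_apply, Fin.ext_iff, Fin.val_zero]
  split_ifs <;> omega

/-- Together with `simplexVertex_succ`: omitting the first vertex, or omitting the last one after a
rotation of the order, gives translates of the same facet by a unit vector. This is the cancellation
between neighbouring cubes. -/
theorem simplexVertex_rotate {m : ℕ} (z : Fin (m + 1) → ℕ) (ρ : Equiv.Perm (Fin (m + 1))) (l : ℕ)
    (hl : l ≤ m) : simplexVertex z ((finRotate (m + 1))⁻¹ * ρ) l = simplexFacet z ρ l := by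
  funext i
  simp only [simplexVertex, simplexFacet, Equiv.Perm.mul_apply]
  congr 2
  refine Fin.cases ?_ (fun t => ?_) (ρ i)
  · have : (finRotate (m + 1))⁻¹ 0 = Fin.last m := by
      rw [Equiv.Perm.inv_eq_iff_eq, finRotate_last]
    rw [this]; simp; omega
  · have : (finRotate (m + 1))⁻¹ t.succ = t.castSucc := by
      rw [Equiv.Perm.inv_eq_iff_eq]
      ext
      rw [coe_finRotate_of_ne_last (Fin.castSucc_lt_last t).ne]
      simp
    rw [this]; simp

/-- A mod 2 Stokes argument: expansion along the column of ones turns each determinant into a sum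
over facets, interior facets cancel, and of the boundary only the face `x 0 = k` contributes, where
`g 1 = g 0 = 1` leaves the same statement one dimension lower. -/
theorem sum_det_simplex_eq_one (n k : ℕ) (g : Fin (n + 1) → (Fin n → ℕ) → ZMod 2)
    (hone : ∀ x, g 0 x = 1)
    (hbot : ∀ i x, (∀ j, x j ≤ k) → x i = 0 → g i.succ x = 0)
    (htop : ∀ i x, (∀ j, x j ≤ k) → x i = k → g i.succ x = g i.castSucc x) :
    ∑ z : Fin n → Fin k, ∑ ρ : Equiv.Perm (Fin n),
      (Matrix.of fun j i : Fin (n + 1) => g i (simplexVertex (fun t => z t) ρ j)).det = 1 := by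
  induction n with
  | zero => simp [hone]
  | succ m ih =>
    set φ : (Fin (m + 1) → Fin (m + 1) → ℕ) → ZMod 2 :=
      fun y => (Matrix.of fun l i : Fin (m + 1) => g i.succ (y l)).det with hφ
    have expand : ∀ (z : Fin (m + 1) → Fin k) (ρ : Equiv.Perm (Fin (m + 1))),
        (Matrix.of fun j i : Fin (m + 2) => g i (simplexVertex (fun t => z t) ρ j)).det =
          ∑ j : Fin (m + 2), φ fun l => simplexVertex (fun t => z t) ρ (j.succAbove l) := by
      intro z ρ
      rw [Matrix.det_succ_column_zero]
      refine Finset.sum_congr rfl fun j _ => ?_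
      simp only [CharTwo.neg_eq, one_pow, one_mul, Matrix.of_apply, hone]
      rfl
    have inner : ∀ (z : Fin (m + 1) → Fin k) (t : Fin m), ∑ ρ : Equiv.Perm (Fin (m + 1)),
        φ (fun l => simplexVertex (fun t => z t) ρ (t.castSucc.succ.succAbove l)) = 0 := by
      intro z t
      refine Finset.sum_involution (fun ρ _ => Equiv.swap t.castSucc t.succ * ρ) ?_ ?_ ?_ ?_
      · intro ρ _
        have : ∀ l : Fin (m + 1), simplexVertex (fun t => (z t : ℕ))
            (Equiv.swap t.castSucc t.succ * ρ) (t.castSucc.succ.succAbove l) =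
            simplexVertex (fun t => (z t : ℕ)) ρ (t.castSucc.succ.succAbove l) := by
          intro l
          apply simplexVertex_swap
          have := Fin.succAbove_ne t.castSucc.succ l
          simpa [Fin.ext_iff] using this
        simp only [this]
        exact CharTwo.add_self_eq_zero _
      · intro ρ _ _ h
        have h1 : Equiv.swap t.castSucc t.succ = 1 := mul_eq_right.mp h
        rw [Equiv.swap_eq_one_iff] at h1
        simp [Fin.ext_iff] at h1
      · simp
      · intro ρ _
        simp
    have zero : ∀ (w : Fin (m + 1) → ℕ) (ρ : Equiv.Perm (Fin (m + 1))) (l : ℕ),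
        simplexFacet w ρ l (ρ.symm 0) = w (ρ.symm 0) := by
      intro w ρ l
      simp [simplexFacet]
    have le : ∀ (i : Fin (m + 1)) (c : ℕ) (hc : c ≤ k) (z : Fin m → Fin k)
        (ρ : Equiv.Perm (Fin (m + 1))) (l : ℕ) (hi : i = ρ.symm 0),
        ∀ j, simplexFacet (i.insertNth c fun j => (z j : ℕ)) ρ l j ≤ k := by
      intro i c hc z ρ l hi j
      refine Fin.succAboveCases i ?_ (fun j => ?_) j
      · rw [hi, zero]; simpa using hc
      · simp only [simplexFacet, Fin.insertNth_apply_succAbove]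
        have := (z j).2
        split_ifs <;> omega
    have bot : ∀ (ρ : Equiv.Perm (Fin (m + 1))) (z : Fin m → Fin k),
        φ (fun l => simplexFacet ((ρ.symm 0).insertNth 0 fun j => (z j : ℕ)) ρ l) = 0 := by
      intro ρ z
      refine Matrix.det_eq_zero_of_column_eq_zero (ρ.symm 0) fun l => ?_
      refine hbot _ _ (le _ _ (Nat.zero_le _) z ρ l rfl) ?_
      exact (zero _ ρ l).trans (by simp)
    -- On the top face of a direction `i ≠ 0` the columns of `g i.succ` and `g i.castSucc` coincide,
    -- and both are still present; for `i = 0` the second one is the deleted column of ones.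
    have top : ∀ (ρ : Equiv.Perm (Fin (m + 1))) (z : Fin m → Fin k), ρ.symm 0 ≠ 0 →
        φ (fun l => simplexFacet ((ρ.symm 0).insertNth k fun j => (z j : ℕ)) ρ l) = 0 := by
      intro ρ z h
      obtain ⟨s, hs⟩ := Fin.exists_succ_eq.mpr h
      refine Matrix.det_zero_of_column_eq (i := s.succ) (j := s.castSucc)
        (by simp [Fin.ext_iff]) fun l => ?_
      rw [← hs]
      refine htop _ _ (le _ _ le_rfl z ρ l hs) ?_
      rw [hs]
      exact (zero _ ρ l).trans (by simp)
    have face : ∀ (e : Equiv.Perm (Fin m)) (z : Fin m → Fin k),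
        φ (fun l => simplexFacet ((0 : Fin (m + 1)).insertNth k fun j => (z j : ℕ))
          (Equiv.Perm.decomposeFin.symm (0, e)) l) =
        (Matrix.of fun j i : Fin (m + 1) =>
          (Fin.cons (fun _ => 1) (fun (i : Fin m) x => g i.succ.succ (Fin.cons k x)) :
            Fin (m + 1) → (Fin m → ℕ) → ZMod 2) i (simplexVertex (fun t => z t) e j)).det := by
      intro e z
      have hcons : ∀ l : ℕ, simplexFacet ((0 : Fin (m + 1)).insertNth k fun j => (z j : ℕ))
          (Equiv.Perm.decomposeFin.symm (0, e)) l =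
          Fin.cons k (simplexVertex (fun t => (z t : ℕ)) e l) := by
        intro l
        funext i
        refine Fin.cases ?_ (fun i => ?_) i
        · simp [simplexFacet]
        · simp [simplexFacet, simplexVertex]
      simp only [hφ]
      congr 1
      ext l i
      simp only [Matrix.of_apply, hcons]
      refine Fin.cases ?_ (fun i => ?_) i
      · have := htop 0 (Fin.cons k (simplexVertex (fun t => (z t : ℕ)) e l)) ?_ (by simp)
        · rw [this]; simp [hone]
        · intro j
          refine Fin.cases (by simp) (fun j => ?_) j
          have := (z j).2
          simp only [simplexVertex, Fin.cons_succ]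
          split_ifs <;> omega
      · simp
    have := ih (Fin.cons (fun _ => 1) (fun (i : Fin m) x => g i.succ.succ (Fin.cons k x)))
      (by simp) ?_ ?_
    · rw [← this]
      simp only [expand]
      have split : ∀ (z : Fin (m + 1) → Fin k), ∑ ρ : Equiv.Perm (Fin (m + 1)),
          ∑ j : Fin (m + 2), φ (fun l => simplexVertex (fun t => z t) ρ (j.succAbove l)) =
          ∑ ρ : Equiv.Perm (Fin (m + 1)),
            ((φ fun l => simplexFacet (fun j => (z j : ℕ) + if j = ρ.symm 0 then 1 else 0) ρ l) +
              φ fun l => simplexFacet (fun j => (z j : ℕ)) ρ l) := by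
        intro z
        rw [Finset.sum_comm, Fin.sum_univ_succ, Fin.sum_univ_castSucc]
        simp only [inner, Finset.sum_const_zero, zero_add]
        rw [Finset.sum_add_distrib]
        congr 1
        · simp [simplexVertex_succ]
        · rw [← Equiv.sum_comp (Equiv.mulLeft (finRotate (m + 1))⁻¹)]
          refine Finset.sum_congr rfl fun ρ _ => ?_
          congr 1
          funext l
          rw [← simplexVertex_rotate _ _ _ (Nat.lt_succ_iff.mp l.2)]
          simp
      simp only [split]
      rw [Finset.sum_comm]
      have tele : ∀ ρ : Equiv.Perm (Fin (m + 1)), _ := fun ρ =>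
        sum_telescope_coord (k := k) (ρ.symm 0) fun w => φ fun l => simplexFacet w ρ l
      simp only [tele, bot, add_zero]
      rw [← Equiv.Perm.decomposeFin.symm.sum_comp, Fintype.sum_prod_type, Fin.sum_univ_succ,
        Finset.sum_eq_zero (s := Finset.univ (α := Fin m)), add_zero, Finset.sum_comm]
      · refine Finset.sum_congr rfl fun z _ => Finset.sum_congr rfl fun e _ => ?_
        have h0 : (Equiv.Perm.decomposeFin.symm ((0 : Fin (m + 1)), e)).symm 0 = 0 := by
          rw [Equiv.symm_apply_eq]; simp
        rw [h0, face]
      · intro p _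
        refine Finset.sum_eq_zero fun e _ => Finset.sum_eq_zero fun z _ => top _ _ ?_
        intro h
        rw [Equiv.symm_apply_eq] at h
        simp [Fin.ext_iff] at h
    · intro i x hx hi
      simp only [Fin.cons_succ]
      exact hbot i.succ _ (fun j => Fin.cases (by simp) (fun j => by simpa using hx j) j)
        (by simpa using hi)
    · intro i x hx hi
      have hle : ∀ j, (Fin.cons k x : Fin (m + 1) → ℕ) j ≤ k :=
        fun j => Fin.cases (by simp) (fun j => by simpa using hx j) j
      simp only [Fin.cons_succ]
      rw [htop i.succ _ hle (by simpa using hi)]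
      cases m with
      | zero => exact i.elim0
      | succ m =>
        refine Fin.cases ?_ (fun i => ?_) i
        · simpa [hone] using htop 0 _ hle (by simp)
        · rfl

/-- Lebesgue's covering theorem for a discrete cube: if no class of a labelling of `{0, …, k}ⁿ`
touches two opposite faces, then some unit cube carries `n + 1` different labels. -/
theorem exists_cube_injective_labels {n k : ℕ} {α : Type*} (c : (Fin n → ℕ) → α)
    (hc : ∀ i x y, (∀ j, x j ≤ k) → (∀ j, y j ≤ k) → x i = 0 → y i = k → c x ≠ c y) :
    ∃ (z : Fin n → ℕ) (y : Fin (n + 1) → Fin n → ℕ), (∀ i, z i < k) ∧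
      (∀ j i, z i ≤ y j i ∧ y j i ≤ z i + 1) ∧ Function.Injective fun j => c (y j) := by
  classical
  -- `P i x`: the class of `x` touches none of the first `i` bottom faces. It depends only on the
  -- label, so equal labels give equal rows and a zero determinant. On the top face of direction `i`
  -- the condition for `t = i` is automatic.
  let P : Fin (n + 1) → (Fin n → ℕ) → Prop := fun i x =>
    ∀ t : Fin n, t.castSucc < i → ∀ y, (∀ j, y j ≤ k) → y t = 0 → c x ≠ c y
  have key := sum_det_simplex_eq_one n k (fun i x => if P i x then 1 else 0) ?_ ?_ ?_
  · have hne := Finset.exists_ne_zero_of_sum_ne_zero (key.trans_ne one_ne_zero)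
    obtain ⟨z, -, hz⟩ := hne
    obtain ⟨ρ, -, hρ⟩ := Finset.exists_ne_zero_of_sum_ne_zero hz
    refine ⟨fun t => z t, fun j => simplexVertex (fun t => z t) ρ j, fun i => (z i).2, ?_, ?_⟩
    · intro j i
      simp only [simplexVertex]
      split_ifs <;> omega
    · intro j j' h
      by_contra hj
      refine hρ (Matrix.det_zero_of_row_eq hj ?_)
      funext i
      simp only [Matrix.of_apply, P]
      simp only at h
      rw [h]
  · intro x
    simp [P]
  · intro i x hx hi
    have : ¬ P i.succ x := fun h => h i (Fin.castSucc_lt_succ) x hx hi rfl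
    simp [this]
  · intro i x hx hi
    have : P i.succ x ↔ P i.castSucc x := by
      constructor
      · intro h t ht
        exact h t (ht.trans Fin.castSucc_lt_succ)
      · intro h t ht y hy hy0
        rcases eq_or_ne t i with rfl | hti
        · exact (hc _ y x hy hx hy0 hi).symm
        · refine h t ?_ y hy hy0
          simp only [Fin.lt_def, Fin.val_castSucc, Fin.val_succ] at ht ⊢
          have := Fin.val_ne_of_ne hti
          omega
    simp [this]

/-! ### Large cubes force infinite dimension -/

/-- `X` contains, at suitable scales, coarse copies of arbitrarily large cubes of arbitrarily large
dimension. -/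
def HasLargeCubes (X : Type*) [PseudoMetricSpace X] : Prop :=
  ∀ n : ℕ, ∃ (m : ℝ) (k : ℕ) (φ : (Fin n → ℕ) → X), 0 < m ∧
    (∀ z y, (∀ i, z i < k) → (∀ i, z i ≤ y i ∧ y i ≤ z i + 1) → dist (φ y) (φ z) ≤ m) ∧
    ∀ i x y, (∀ j, x j ≤ k) → (∀ j, y j ≤ k) → x i = 0 → y i = k → n * m + n < dist (φ x) (φ y)

theorem asymptoticANDim_eq_top {X : Type*} [PseudoMetricSpace X] (hX : HasLargeCubes X) :
    asymptoticANDim X = ⊤ := by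
  simp only [asymptoticANDim, iInf_eq_top]
  rintro n ⟨c, b, hc, hb, h⟩
  exfalso
  -- One number `N` serves as dimension of the cube and as bound for both constants, so that `c * m
  -- + b ≤ N * m + N`.
  obtain ⟨N, hN⟩ := exists_nat_ge (max (max c b) (n + 1 : ℕ))
  obtain ⟨⟨hcN, hbN⟩, hnN⟩ := by simpa only [max_le_iff] using hN
  obtain ⟨m, k, φ, hm, hnear, hfar⟩ := hX N
  obtain ⟨𝒰, hcov, hbd, hmul⟩ := h m hm
  have hU : ∀ x, ∃ U ∈ 𝒰, φ x ∈ U := by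
    intro x
    have : φ x ∈ ⋃₀ 𝒰 := hcov ▸ Set.mem_univ _
    simpa using this
  choose U hU𝒰 hmem using hU
  have hsep : ∀ i x y, (∀ j, x j ≤ k) → (∀ j, y j ≤ k) → x i = 0 → y i = k → U x ≠ U y := by
    intro i x y hx hy hx0 hyk he
    have h1 := hbd _ (hU𝒰 x) _ (hmem x) (φ y) (he ▸ hmem y)
    have h2 := hfar i x y hx hy hx0 hyk
    have h3 : c * m ≤ N * m := mul_le_mul_of_nonneg_right hcN hm.le
    linarith
  obtain ⟨z, y, hz, hy, hinj⟩ := exists_cube_injective_labels U hsep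
  have hsub : Set.range (fun j => U (y j)) ⊆
      {V ∈ 𝒰 | (V ∩ Metric.closedBall (φ z) m).Nonempty} := by
    rintro _ ⟨j, rfl⟩
    exact ⟨hU𝒰 _, φ (y j), hmem _, hnear _ _ hz (hy j)⟩
  have h1 := (Set.encard_le_encard hsub).trans (hmul (φ z))
  rw [← Set.image_univ, hinj.encard_image, Set.encard_univ, ENat.card_eq_coe_fintype_card,
    Fintype.card_fin] at h1
  have h2 : N + 1 ≤ n + 1 := by exact_mod_cast h1
  have h3 : n + 1 ≤ N := by exact_mod_cast hnN
  omega

/-! ### Lines with chords -/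

/-- The half-line with vertex set `ℕ`, with additional edges (chords) given by `R`. -/
def lineGraph (R : ℕ → ℕ → Prop) : SimpleGraph ℕ :=
  SimpleGraph.fromRel fun u v => v = u + 1 ∨ R u v

theorem lineGraph_adj_succ (R : ℕ → ℕ → Prop) (u : ℕ) : (lineGraph R).Adj u (u + 1) := by
  simp [lineGraph]

theorem lineGraph_reachable_zero (R : ℕ → ℕ → Prop) (u : ℕ) : (lineGraph R).Reachable 0 u := by
  induction u with
  | zero => exact SimpleGraph.Reachable.refl 0
  | succ u ih => exact ih.trans (lineGraph_adj_succ R u).reachable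

theorem lineGraph_connected (R : ℕ → ℕ → Prop) : (lineGraph R).Connected :=
  ⟨fun u v => (lineGraph_reachable_zero R u).symm.trans (lineGraph_reachable_zero R v)⟩

theorem lineGraph_dist_add_le (R : ℕ → ℕ → Prop) (u t : ℕ) :
    (lineGraph R).dist u (u + t) ≤ t := by
  induction t with
  | zero => simp
  | succ t ih =>
    have h1 : (lineGraph R).dist u (u + t + 1) ≤ _ :=
      (lineGraph_connected R).dist_triangle (v := u + t)
    rw [SimpleGraph.dist_eq_one_iff_adj.mpr (lineGraph_adj_succ R (u + t))] at h1
    rw [← add_assoc]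
    omega

theorem lineGraph_dist_chord_le {R : ℕ → ℕ → Prop} {u v : ℕ} (h : R u v) :
    (lineGraph R).dist u v ≤ 1 := by
  rcases eq_or_ne u v with rfl | hne
  · simp
  · refine (SimpleGraph.dist_eq_one_iff_adj.mpr ?_).le
    simp [lineGraph, hne, h]

/-- Induction along walks of a line with chords: a property of points and lengths that holds at
the start and survives unit steps and chords holds for all points at bounded distance. -/
theorem lineGraph_dist_induction {R : ℕ → ℕ → Prop} (hR : ∀ u v, R u v → R v u) {v : ℕ}
    (P : ℕ → ℕ → Prop) (hv : P 0 v) (hup : ∀ l u, P l u → P (l + 1) (u + 1))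
    (hdown : ∀ l u, P l (u + 1) → P (l + 1) u) (hchord : ∀ l u w, R u w → P l u → P (l + 1) w)
    (u : ℕ) : P ((lineGraph R).dist v u) u := by
  have key : ∀ (l u : ℕ) (w : (lineGraph R).Walk v u), w.length = l → P l u := by
    intro l
    induction l with
    | zero =>
      intro u w hw
      obtain rfl := SimpleGraph.Walk.eq_of_length_eq_zero hw
      exact hv
    | succ l ih =>
      intro u w hw
      have hnil : ¬ w.Nil := by
        rw [← SimpleGraph.Walk.length_eq_zero_iff]; omega
      have hadj := w.adj_penultimate hnil
      have hP := ih _ w.dropLast (by simp; omega)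
      simp only [lineGraph, SimpleGraph.fromRel_adj] at hadj
      rcases hadj.2 with (h | h) | h | h
      · rw [h]; exact hup _ _ hP
      · exact hchord _ _ _ h hP
      · exact hdown _ _ (Eq.subst (motive := P l) h hP)
      · exact hchord _ _ _ (hR _ _ h) hP
  obtain ⟨w, hw⟩ := (lineGraph_connected R).exists_walk_length_eq_dist v u
  exact key _ _ w hw

/-- The source of all lower bounds on distances: chords do not change `f`, so only unit steps count.
-/
theorem lineGraph_lipschitz {R : ℕ → ℕ → Prop} (hR : ∀ u v, R u v → R v u) (f : ℕ → ℤ)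
    (hf : ∀ u, |f (u + 1) - f u| ≤ 1) (hinv : ∀ u v, R u v → f u = f v) (u v : ℕ) :
    |f v - f u| ≤ (lineGraph R).dist u v := by
  refine lineGraph_dist_induction hR (fun l w => |f w - f u| ≤ l) (by simp) ?_ ?_ ?_ v
  · intro l w h
    have := hf w
    push_cast
    rw [abs_le] at *
    omega
  · intro l w h
    have := hf w
    push_cast
    rw [abs_le] at *
    omega
  · intro l w w' hw h
    rw [← hinv _ _ hw]
    push_cast
    omega

/-! ### A line with chords containing a coarse cube -/

/-- A finite line with a matching of chords, together with a coarsely embedded cube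
`{0, …, k}ⁿ`. -/
structure CubeModel (n k : ℕ) where
  /-- The chords join points of the open interval `(0, size)`. -/
  size : ℕ
  /-- The chords. -/
  chord : ℕ → ℕ → Prop
  /-- Lipschitz functions that agree with the coordinates of the cube. -/
  coord : Fin n → ℕ → ℤ
  /-- The cube. -/
  cube : (Fin n → ℕ) → ℕ
  chord_symm : ∀ s t, chord s t → chord t s
  chord_unique : ∀ s t t', chord s t → chord s t' → t = t'
  chord_mem : ∀ s t, chord s t → 0 < s ∧ s < size
  coord_zero : ∀ i, coord i 0 = 0
  coord_eq_zero : ∀ i s, size ≤ s → coord i s = 0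
  coord_lipschitz : ∀ i s, |coord i (s + 1) - coord i s| ≤ 1
  coord_chord : ∀ i s t, chord s t → coord i s = coord i t
  cube_mem : ∀ x, 0 < cube x ∧ cube x < size
  dist_cube_le : ∀ z y, (∀ i, z i < k) → (∀ i, z i ≤ y i ∧ y i ≤ z i + 1) →
    (lineGraph chord).dist (cube z) (cube y) ≤ 6 * n
  coord_cube : ∀ i x, x i ≤ k → coord i (cube x) = x i

section Construction

variable (n k : ℕ)

/-- The length of the part of the line that is reserved for a point of the cube. -/
def blockLength : ℕ := 2 * n + 2 * k + 8

/-- An enumeration of the cube. -/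
def cubeEquiv : (Fin n → Fin (k + 1)) ≃ Fin (Fintype.card (Fin n → Fin (k + 1))) :=
  Fintype.equivFin _

variable {n k}

/-- The point with offset `t` in the block of `x`. -/
def blockPoint (x : Fin n → Fin (k + 1)) (t : ℕ) : ℕ :=
  blockLength n k * cubeEquiv n k x + t

/-- The `i`-th coordinate function on the block of `x`: it increases from `x i` to `x i + 1`
between the two chord ends that belong to the direction `i`, and decays to zero at both ends of
the block. -/
def blockCoord (x : Fin n → Fin (k + 1)) (i : Fin n) (t : ℕ) : ℕ :=
  (x i + if k + 4 + 2 * i ≤ t then 1 else 0) - (k + 3 - t) - (t - (k + 3 + 2 * n))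

/-- The `i`-th coordinate function on the line. -/
def lineCoord (i : Fin n) (s : ℕ) : ℤ :=
  if h : s / blockLength n k < Fintype.card (Fin n → Fin (k + 1)) then
    blockCoord ((cubeEquiv n k).symm ⟨_, h⟩) i (s % blockLength n k) else 0

theorem blockLength_pos : 0 < blockLength n k := by
  unfold blockLength; omega

theorem blockPoint_lt (x : Fin n → Fin (k + 1)) {t : ℕ} (ht : t < blockLength n k) :
    blockPoint x t < blockLength n k * Fintype.card (Fin n → Fin (k + 1)) := by
  have h1 := (cubeEquiv n k x).2
  have h2 := Nat.mul_le_mul_left (blockLength n k) (Nat.succ_le_of_lt h1)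
  rw [Nat.succ_eq_add_one, mul_add, mul_one] at h2
  unfold blockPoint
  omega

theorem blockPoint_inj {x y : Fin n → Fin (k + 1)} {t u : ℕ} (ht : t < blockLength n k)
    (hu : u < blockLength n k) (h : blockPoint x t = blockPoint y u) : x = y ∧ t = u := by
  have h1 := congrArg (· / blockLength n k) h
  have h2 := congrArg (· % blockLength n k) h
  simp only [blockPoint, Nat.mul_add_div blockLength_pos, Nat.div_eq_of_lt ht,
    Nat.div_eq_of_lt hu, add_zero, Nat.mul_add_mod, Nat.mod_eq_of_lt ht,
    Nat.mod_eq_of_lt hu] at h1 h2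
  exact ⟨(cubeEquiv n k).injective (Fin.ext h1), h2⟩

theorem lineCoord_blockPoint (i : Fin n) (x : Fin n → Fin (k + 1)) {t : ℕ}
    (ht : t < blockLength n k) : lineCoord (k := k) i (blockPoint x t) = blockCoord x i t := by
  have h1 : blockPoint x t / blockLength n k = cubeEquiv n k x := by
    rw [blockPoint, Nat.mul_add_div blockLength_pos, Nat.div_eq_of_lt ht, add_zero]
  have h2 : blockPoint x t % blockLength n k = t := by
    rw [blockPoint, Nat.mul_add_mod, Nat.mod_eq_of_lt ht]
  rw [lineCoord, dif_pos (h1.trans_lt (Fin.is_lt _))]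
  simp [h1, h2]

/-- The margins of a block are long enough for a coordinate, at most `k + 1`, to decay to zero;
hence consecutive blocks fit together whatever the enumeration of the cube. -/
theorem lineCoord_mul (i : Fin n) (q : ℕ) :
    lineCoord (k := k) i (blockLength n k * q) = 0 := by
  unfold lineCoord
  split_ifs with h
  · have := ((cubeEquiv n k).symm ⟨_, h⟩ i).2
    simp only [blockCoord, Nat.mul_mod_right]
    split_ifs <;> omega
  · rfl

theorem lineCoord_lipschitz (i : Fin n) (s : ℕ) :
    |lineCoord (k := k) i (s + 1) - lineCoord (k := k) i s| ≤ 1 := by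
  by_cases h : s / blockLength n k < Fintype.card (Fin n → Fin (k + 1))
  · obtain ⟨x, t, ht, rfl⟩ : ∃ x t, t < blockLength n k ∧ s = blockPoint (k := k) (n := n) x t := by
      refine ⟨(cubeEquiv n k).symm ⟨_, h⟩, s % blockLength n k, Nat.mod_lt _ blockLength_pos, ?_⟩
      simp [blockPoint, Nat.div_add_mod]
    rw [lineCoord_blockPoint i x ht]
    have hi := i.2
    have hx := (x i).2
    by_cases ht' : t + 1 < blockLength n k
    · have e : blockPoint x t + 1 = blockPoint x (t + 1) := by unfold blockPoint; omega
      rw [e, lineCoord_blockPoint i x ht', abs_le]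
      unfold blockCoord
      split_ifs <;> omega
    · have e : blockPoint x t + 1 = blockLength n k * (cubeEquiv n k x + 1) := by
        rw [mul_add]; unfold blockPoint; omega
      rw [e, lineCoord_mul, abs_le]
      unfold blockCoord
      unfold blockLength at ht ht'
      split_ifs <;> omega
  · have h' : ¬ (s + 1) / blockLength n k < Fintype.card (Fin n → Fin (k + 1)) :=
      fun h' => h ((Nat.div_le_div_right (Nat.le_succ s)).trans_lt h')
    rw [lineCoord, lineCoord, dif_neg h, dif_neg h']
    simp

/-- A chord leads from the block of `x` to the block of `x + eᵢ`. -/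
def HalfChord (n k s t : ℕ) : Prop :=
  ∃ (x y : Fin n → Fin (k + 1)) (i : Fin n), (y i : ℕ) = x i + 1 ∧ (∀ j, j ≠ i → y j = x j) ∧
    s = blockPoint x (k + 4 + 2 * i) ∧ t = blockPoint y (k + 3 + 2 * i)

theorem HalfChord.mem {s t : ℕ} (h : HalfChord n k s t) :
    (0 < s ∧ s < blockLength n k * Fintype.card (Fin n → Fin (k + 1))) ∧
      0 < t ∧ t < blockLength n k * Fintype.card (Fin n → Fin (k + 1)) := by
  obtain ⟨x, y, i, -, -, rfl, rfl⟩ := h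
  have hi := i.2
  refine ⟨⟨?_, blockPoint_lt x ?_⟩, ?_, blockPoint_lt y ?_⟩ <;>
    simp only [blockPoint, blockLength] <;> omega

/-- In the direction of the chord, the outgoing end lies just after the jump to `x i + 1` and the
incoming end just before the jump from `y i = x i + 1`. For any other direction the jump does not
separate the two offsets. -/
theorem HalfChord.lineCoord_eq {s t : ℕ} (h : HalfChord n k s t) (i : Fin n) :
    lineCoord (k := k) i s = lineCoord (k := k) i t := by
  obtain ⟨x, y, j, hj, hne, rfl, rfl⟩ := h
  have hj2 := j.2
  have hi2 := i.2
  rw [lineCoord_blockPoint i x (by unfold blockLength; omega),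
    lineCoord_blockPoint i y (by unfold blockLength; omega)]
  unfold blockCoord
  rcases eq_or_ne i j with rfl | hij
  · split_ifs <;> omega
  · rw [hne i hij]
    have := Fin.val_ne_of_ne hij
    split_ifs <;> omega

/-- The point of the cube with the given coordinates, truncated at `k`. -/
def truncate (k : ℕ) (x : Fin n → ℕ) : Fin n → Fin (k + 1) :=
  fun i => ⟨min (x i) k, by omega⟩

/-- The directions are treated in order while the offset moves through the block. A direction that
changes costs one step to the outgoing end, one chord, and two steps to the next incoming end; an
unchanged one costs two steps. -/
theorem dist_blockPoint_le (R : ℕ → ℕ → Prop) (hR : ∀ s t, HalfChord n k s t → R s t)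
    (z y : Fin n → ℕ) (hz : ∀ i, z i < k) (hy : ∀ i, z i ≤ y i ∧ y i ≤ z i + 1) (l : ℕ)
    (hl : l ≤ n) : (lineGraph R).dist (blockPoint (truncate k z) (k + 3))
      (blockPoint (truncate k fun i => if (i : ℕ) < l then y i else z i) (k + 3 + 2 * l)) ≤
        4 * l := by
  have tri : ∀ a b c, (lineGraph R).dist a c ≤ (lineGraph R).dist a b + (lineGraph R).dist b c :=
    fun a b c => (lineGraph_connected R).dist_triangle
  have shift : ∀ (x : Fin n → Fin (k + 1)) (t u : ℕ),
      (lineGraph R).dist (blockPoint x t) (blockPoint x (t + u)) ≤ u := by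
    intro x t u
    simpa only [blockPoint, add_assoc] using lineGraph_dist_add_le R (blockPoint x t) u
  induction l with
  | zero => simp
  | succ l ih =>
    specialize ih (by omega)
    set w : Fin n → ℕ := fun i => if (i : ℕ) < l then y i else z i with hw
    set w' : Fin n → ℕ := fun i => if (i : ℕ) < l + 1 then y i else z i with hw'
    let i : Fin n := ⟨l, by omega⟩
    have hother : ∀ j, j ≠ i → w' j = w j := by
      intro j hj
      have : (j : ℕ) ≠ l := fun h => hj (Fin.ext h)
      simp only [hw, hw']
      split_ifs <;> first | rfl | omega
    have hwi : w i = z i := by simp [hw, i]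
    have hwi' : w' i = y i := by simp [hw', i]
    have hzi := hz i
    rcases eq_or_ne (y i) (z i) with he | he
    · have : w' = w := by
        funext j
        by_cases hj : j = i
        · rw [hj, hwi, hwi', he]
        · exact hother j hj
      rw [this]
      have h1 := shift (truncate k w) (k + 3 + 2 * l) 2
      have h2 := tri (blockPoint (truncate k z) (k + 3))
        (blockPoint (truncate k w) (k + 3 + 2 * l)) (blockPoint (truncate k w) (k + 3 + 2 * l + 2))
      rw [mul_add 2, mul_one, ← add_assoc]
      omega
    · have hyi : y i = z i + 1 := by have := hy i; omega
      have hchord : R (blockPoint (truncate k w) (k + 4 + 2 * l))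
          (blockPoint (truncate k w') (k + 3 + 2 * l)) := by
        refine hR _ _ ⟨_, _, i, ?_, ?_, rfl, rfl⟩
        · simp only [truncate, hwi, hwi']; omega
        · intro j hj
          simp only [truncate, hother j hj]
      have h1 := shift (truncate k w) (k + 3 + 2 * l) 1
      rw [show k + 3 + 2 * l + 1 = k + 4 + 2 * l by ring] at h1
      have h2 := lineGraph_dist_chord_le hchord
      have h3 := shift (truncate k w') (k + 3 + 2 * l) 2
      have h4 := tri (blockPoint (truncate k z) (k + 3))
        (blockPoint (truncate k w) (k + 3 + 2 * l)) (blockPoint (truncate k w) (k + 4 + 2 * l))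
      have h5 := tri (blockPoint (truncate k z) (k + 3))
        (blockPoint (truncate k w) (k + 4 + 2 * l)) (blockPoint (truncate k w') (k + 3 + 2 * l))
      have h6 := tri (blockPoint (truncate k z) (k + 3))
        (blockPoint (truncate k w') (k + 3 + 2 * l))
        (blockPoint (truncate k w') (k + 3 + 2 * l + 2))
      rw [mul_add 2, mul_one, ← add_assoc]
      omega

variable (n k)

/-- The model in which the points of the cube occupy consecutive blocks of the line. -/
def cubeModel : CubeModel n k where
  size := blockLength n k * Fintype.card (Fin n → Fin (k + 1))
  chord s t := HalfChord n k s t ∨ HalfChord n k t s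
  coord := lineCoord (k := k)
  cube x := blockPoint (truncate k x) (k + 3)
  chord_symm s t h := h.symm
  chord_unique s t t' h h' := by
    -- Outgoing and incoming offsets have different parity.
    have ends : ∀ (x x' : Fin n → Fin (k + 1)) (i i' : Fin n),
        blockPoint x (k + 4 + 2 * i) ≠ blockPoint x' (k + 3 + 2 * i') := by
      intro x x' i i' he
      have := i.2
      have := i'.2
      have := (blockPoint_inj (by unfold blockLength; omega) (by unfold blockLength; omega) he).2
      omega
    rcases h with ⟨x, y, i, h1, h2, rfl, rfl⟩ | ⟨x, y, i, h1, h2, rfl, rfl⟩ <;>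
      rcases h' with ⟨x', y', i', h1', h2', he, rfl⟩ | ⟨x', y', i', h1', h2', rfl, he⟩
    · have := i.2
      have := i'.2
      obtain ⟨rfl, hi⟩ := blockPoint_inj (by unfold blockLength; omega)
        (by unfold blockLength; omega) he
      obtain rfl : i = i' := Fin.ext (by omega)
      have : y = y' := by
        funext j
        by_cases hj : j = i
        · rw [hj]; exact Fin.ext (by omega)
        · rw [h2 j hj, h2' j hj]
      rw [this]
    · exact absurd he (ends _ _ _ _)
    · exact absurd he.symm (ends _ _ _ _)
    · have := i.2
      have := i'.2
      obtain ⟨rfl, hi⟩ := blockPoint_inj (by unfold blockLength; omega)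
        (by unfold blockLength; omega) he
      obtain rfl : i = i' := Fin.ext (by omega)
      have : x = x' := by
        funext j
        by_cases hj : j = i
        · rw [hj]; exact Fin.ext (by omega)
        · rw [← h2 j hj, ← h2' j hj]
      rw [this]
  chord_mem s t h := h.elim (fun h => h.mem.1) (fun h => h.mem.2)
  coord_zero i := by simpa using lineCoord_mul (k := k) i 0
  coord_eq_zero i s hs := by
    rw [lineCoord, dif_neg]
    rw [not_lt, Nat.le_div_iff_mul_le blockLength_pos, mul_comm]
    exact hs
  coord_lipschitz := lineCoord_lipschitz
  coord_chord i s t h := h.elim (fun h => h.lineCoord_eq i) (fun h => (h.lineCoord_eq i).symm)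
  cube_mem x := ⟨by unfold blockPoint; omega, blockPoint_lt _ (by unfold blockLength; omega)⟩
  dist_cube_le z y hz hy := by
    have h1 := dist_blockPoint_le (fun s t => HalfChord n k s t ∨ HalfChord n k t s)
      (fun _ _ => Or.inl) z y hz hy n le_rfl
    simp only [Fin.is_lt, if_true] at h1
    rw [show (fun i => y i) = y from rfl] at h1
    -- The return to offset `k + 3` adds `2 * n` to the previous `4 * n`.
    have h2 := lineGraph_dist_add_le (fun s t => HalfChord n k s t ∨ HalfChord n k t s)
      (blockPoint (truncate k y) (k + 3)) (2 * n)
    rw [SimpleGraph.dist_comm] at h2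
    have h3 := (lineGraph_connected fun s t => HalfChord n k s t ∨ HalfChord n k t s).dist_triangle
      (u := blockPoint (truncate k z) (k + 3)) (v := blockPoint (truncate k y) (k + 3 + 2 * n))
      (w := blockPoint (truncate k y) (k + 3))
    have e : blockPoint (truncate k y) (k + 3) + 2 * n =
      blockPoint (truncate k y) (k + 3 + 2 * n) := by unfold blockPoint; omega
    rw [e] at h2
    omega
  coord_cube i x hx := by
    rw [lineCoord_blockPoint _ _ (by unfold blockLength; omega)]
    have : ¬ k + 4 + 2 * (i : ℕ) ≤ k + 3 := by omega
    simp only [blockCoord, truncate, this, if_false]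
    omega

end Construction

/-! ### Linear interpolation -/

/-- The function that takes the value `a * F s` at `a * s` and is linear in between. -/
def interpolate (a : ℕ) (F : ℕ → ℤ) (d : ℕ) : ℤ :=
  a * F (d / a) + (d % a : ℕ) * (F (d / a + 1) - F (d / a))

theorem interpolate_mul {a : ℕ} (ha : 0 < a) (F : ℕ → ℤ) (s : ℕ) :
    interpolate a F (a * s) = a * F s := by
  simp [interpolate, ha]

theorem interpolate_lipschitz {a : ℕ} (ha : 0 < a) {F : ℕ → ℤ}
    (hF : ∀ s, |F (s + 1) - F s| ≤ 1) (d : ℕ) :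
    |interpolate a F (d + 1) - interpolate a F d| ≤ 1 := by
  obtain ⟨s, t, ht, rfl⟩ : ∃ s t, t < a ∧ d = a * s + t :=
    ⟨d / a, d % a, Nat.mod_lt _ ha, (Nat.div_add_mod d a).symm⟩
  have h0 : interpolate a F (a * s + t) = a * F s + t * (F (s + 1) - F s) := by
    simp [interpolate, Nat.mul_add_div ha, Nat.div_eq_of_lt ht, Nat.mod_eq_of_lt ht]
  have h1 : interpolate a F (a * s + t + 1) = a * F s + (t + 1) * (F (s + 1) - F s) := by
    rcases (Nat.succ_le_of_lt ht).lt_or_eq with h | h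
    · rw [add_assoc]
      simp [interpolate, Nat.mul_add_div ha, Nat.div_eq_of_lt h, Nat.mod_eq_of_lt h]
    · have : a * s + t + 1 = a * (s + 1) := by rw [mul_add]; omega
      rw [this, interpolate_mul ha, ← h]
      push_cast
      ring
  rw [h0, h1]
  convert hF s using 2
  ring

/-! ### A sequence of models on one line -/

/-- The side length of the cube of dimension `p`. -/
def sideLength (p : ℕ) : ℕ := p * (6 * p + 1) + p + 1

/-- The model with a cube of dimension `p`. -/
def model (p : ℕ) : CubeModel p (sideLength p) := cubeModel p (sideLength p)

/-- The point at which the `p`-th model starts; the model is scaled by a factor that is large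
compared with everything before. -/
def start : ℕ → ℕ
  | 0 => 0
  | p + 1 => start p + (start p + (model p).size + p + 2) ^ (p + 2) * (model p).size

/-- The factor by which the `p`-th model is scaled. -/
def scale (p : ℕ) : ℕ := (start p + (model p).size + p + 2) ^ (p + 2)

theorem start_succ (p : ℕ) : start (p + 1) = start p + scale p * (model p).size := rfl

theorem base_le_scale (p : ℕ) : start p + (model p).size + p + 2 ≤ scale p :=
  Nat.le_self_pow (by omega) _

theorem scale_pos (p : ℕ) : 0 < scale p := by
  have := base_le_scale p
  omega

theorem size_pos (p : ℕ) : 0 < (model p).size := by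
  have := (model p).cube_mem 0
  omega

theorem start_mono : Monotone start :=
  monotone_nat_of_le_succ fun p => by rw [start_succ]; omega

theorem scale_mono : Monotone scale :=
  monotone_nat_of_le_succ fun p => by
    have h1 := base_le_scale (p + 1)
    have h2 := start_succ p
    have h3 := Nat.le_mul_of_pos_right (scale p) (size_pos p)
    omega

/-- The point `s` of the `p`-th model. -/
def node (p s : ℕ) : ℕ := start p + scale p * s

theorem node_bounds {p s : ℕ} (hs : 0 < s) (hs' : s < (model p).size) :
    start p + scale p ≤ node p s ∧ node p s + scale p ≤ start (p + 1) := by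
  have h1 := Nat.le_mul_of_pos_right (scale p) hs
  have h2 := Nat.mul_le_mul_left (scale p) (Nat.succ_le_of_lt hs')
  rw [Nat.succ_eq_add_one, mul_add, mul_one] at h2
  rw [start_succ, node]
  omega

/-- `u` is one of the interior points of the models. -/
def IsNode (u : ℕ) : Prop := ∃ p s, 0 < s ∧ s < (model p).size ∧ u = node p s

theorem le_of_start_le_node {P p s : ℕ} (hs' : s < (model p).size) (h : start P ≤ node p s) :
    P ≤ p := by
  by_contra hP
  have h1 := start_mono (show p + 1 ≤ P by omega)
  have h2 : node p s < start (p + 1) := by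
    rw [start_succ, node]
    exact Nat.add_lt_add_left (Nat.mul_lt_mul_of_pos_left hs' (scale_pos p)) _
  omega

theorem IsNode.start_add_scale_le {P u : ℕ} (hu : IsNode u) (h : start P ≤ u) :
    start P + scale P ≤ u := by
  obtain ⟨p, s, hs, hs', rfl⟩ := hu
  have hP := le_of_start_le_node hs' h
  have h1 := start_mono hP
  have h2 := scale_mono hP
  have h3 := (node_bounds hs hs').1
  omega

/-- Nodes of one model are multiples of its scale apart; nodes of different models are separated by
the margin at the end of the earlier one. Scales increase, so `scale P` bounds every gap beyond
`start P`. -/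
theorem IsNode.add_scale_le {P u v : ℕ} (hu : IsNode u) (hv : IsNode v) (h : start P ≤ u)
    (huv : u < v) : u + scale P ≤ v := by
  obtain ⟨p, s, hs, hs', rfl⟩ := hu
  obtain ⟨q, t, ht, ht', rfl⟩ := hv
  have hP := scale_mono (le_of_start_le_node hs' h)
  have hu := node_bounds hs hs'
  have hv := node_bounds ht ht'
  rcases lt_trichotomy p q with hpq | rfl | hpq
  · have := start_mono (show p + 1 ≤ q by omega)
    omega
  · have hst : s < t := by
      unfold node at huv
      exact lt_of_mul_lt_mul_left (Nat.lt_of_add_lt_add_left huv) (Nat.zero_le _)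
    have := Nat.mul_le_mul_left (scale p) (Nat.succ_le_of_lt hst)
    rw [Nat.succ_eq_add_one, mul_add, mul_one] at this
    unfold node
    omega
  · have := start_mono (show q + 1 ≤ p by omega)
    omega

theorem IsNode.eq_of_near {P u v : ℕ} (hu : IsNode u) (hv : IsNode v) (h : start P ≤ u)
    (h' : start P ≤ v) (huv : u < v + scale P) (hvu : v < u + scale P) : u = v := by
  rcases lt_trichotomy u v with hlt | rfl | hlt
  · have := hu.add_scale_le hv h hlt
    omega
  · rfl
  · have := hv.add_scale_le hu h' hlt
    omega

theorem node_inj {p s q t : ℕ} (hs : 0 < s) (hs' : s < (model p).size) (ht : 0 < t)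
    (ht' : t < (model q).size) (h : node p s = node q t) : p = q ∧ s = t := by
  have hu := node_bounds hs hs'
  have hv := node_bounds ht ht'
  have hp := scale_pos p
  rcases lt_trichotomy p q with hpq | rfl | hpq
  · have := start_mono (show p + 1 ≤ q by omega)
    omega
  · exact ⟨rfl, Nat.eq_of_mul_eq_mul_left hp (Nat.add_left_cancel h)⟩
  · have := start_mono (show q + 1 ≤ p by omega)
    omega

/-- The chords of all models. -/
def bigChord (u v : ℕ) : Prop :=
  ∃ p s t, (model p).chord s t ∧ u = node p s ∧ v = node p t

theorem bigChord.symm {u v : ℕ} (h : bigChord u v) : bigChord v u := by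
  obtain ⟨p, s, t, h, rfl, rfl⟩ := h
  exact ⟨p, t, s, (model p).chord_symm _ _ h, rfl, rfl⟩

theorem bigChord.isNode {u v : ℕ} (h : bigChord u v) : IsNode u := by
  obtain ⟨p, s, t, h, rfl, rfl⟩ := h
  obtain ⟨hs, hs'⟩ := (model p).chord_mem _ _ h
  exact ⟨p, s, hs, hs', rfl⟩

theorem bigChord.unique {u v w : ℕ} (h : bigChord u v) (h' : bigChord u w) : v = w := by
  obtain ⟨p, s, t, h, rfl, rfl⟩ := h
  obtain ⟨q, s', t', h', he, rfl⟩ := h'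
  obtain ⟨hs, hs'⟩ := (model p).chord_mem _ _ h
  obtain ⟨ht, ht'⟩ := (model q).chord_mem _ _ h'
  obtain ⟨rfl, rfl⟩ := node_inj hs hs' ht ht' he
  rw [(model p).chord_unique _ _ _ h h']

theorem bigChord.lt_start {P u v : ℕ} (h : bigChord u v) (hu : u < start P) : v < start P := by
  obtain ⟨p, s, t, h, rfl, rfl⟩ := h
  obtain ⟨hs, hs'⟩ := (model p).chord_mem _ _ h
  obtain ⟨ht, ht'⟩ := (model p).chord_mem _ _ ((model p).chord_symm _ _ h)
  by_contra hv
  have h1 := start_mono (le_of_start_le_node ht' (not_lt.mp hv))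
  have h2 := (node_bounds hs hs').1
  omega

/-- The line with the chords of all models. -/
def bigGraph : SimpleGraph ℕ := lineGraph bigChord

theorem bigGraph_connected : bigGraph.Connected := lineGraph_connected _

/-! ### The large cubes -/

/-- The `i`-th coordinate function of the `p`-th model on the whole line. -/
def bigCoord (p : ℕ) (i : Fin p) (u : ℕ) : ℤ :=
  interpolate (scale p) ((model p).coord i) (u - start p)

theorem bigCoord_node (p : ℕ) (i : Fin p) (s : ℕ) :
    bigCoord p i (node p s) = scale p * (model p).coord i s := by
  simp [bigCoord, node, interpolate_mul (scale_pos p)]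

/-- Needed so that the chords of the other models also preserve the coordinates of model `p`. -/
theorem bigCoord_eq_zero {p q s : ℕ} (i : Fin p) (hpq : q ≠ p) (hs : 0 < s)
    (hs' : s < (model q).size) : bigCoord p i (node q s) = 0 := by
  have hb := node_bounds hs hs'
  rcases hpq.lt_or_gt with h | h
  · have := start_mono (show q + 1 ≤ p by omega)
    have e : node q s - start p = scale p * 0 := by omega
    rw [bigCoord, e, interpolate_mul (scale_pos p), (model p).coord_zero, mul_zero]
  · have h1 := start_mono (show p + 1 ≤ q by omega)
    rw [start_succ] at h1
    have h2 : (model p).size ≤ (node q s - start p) / scale p := by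
      rw [Nat.le_div_iff_mul_le (scale_pos p), mul_comm]
      omega
    rw [bigCoord, interpolate, (model p).coord_eq_zero _ _ h2,
      (model p).coord_eq_zero _ _ (h2.trans (Nat.le_succ _))]
    simp

theorem bigCoord_sub_le_dist (p : ℕ) (i : Fin p) (u v : ℕ) :
    |bigCoord p i v - bigCoord p i u| ≤ bigGraph.dist u v := by
  refine lineGraph_lipschitz (fun _ _ => bigChord.symm) _ ?_ ?_ u v
  · intro u
    unfold bigCoord
    rcases lt_or_ge u (start p) with h | h
    · rw [show u + 1 - start p = u - start p by omega]
      simp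
    · rw [show u + 1 - start p = u - start p + 1 by omega]
      exact interpolate_lipschitz (scale_pos p) ((model p).coord_lipschitz i) _
  · rintro u v ⟨q, s, t, h, rfl, rfl⟩
    obtain ⟨hs, hs'⟩ := (model q).chord_mem _ _ h
    obtain ⟨ht, ht'⟩ := (model q).chord_mem _ _ ((model q).chord_symm _ _ h)
    by_cases hq : q = p
    · subst hq
      rw [bigCoord_node, bigCoord_node, (model q).coord_chord i _ _ h]
    · rw [bigCoord_eq_zero i hq hs hs', bigCoord_eq_zero i hq ht ht']

theorem dist_node_le (p s t : ℕ) :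
    bigGraph.dist (node p s) (node p t) ≤ scale p * (lineGraph (model p).chord).dist s t := by
  have tri : ∀ a b c, bigGraph.dist a c ≤ bigGraph.dist a b + bigGraph.dist b c :=
    fun a b c => bigGraph_connected.dist_triangle
  have step : ∀ t, bigGraph.dist (node p t) (node p (t + 1)) ≤ scale p := by
    intro t
    rw [show node p (t + 1) = node p t + scale p by unfold node; ring]
    exact lineGraph_dist_add_le bigChord (node p t) (scale p)
  refine lineGraph_dist_induction (model p).chord_symm
    (fun l t => bigGraph.dist (node p s) (node p t) ≤ scale p * l) (by simp) ?_ ?_ ?_ t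
  · intro l t h
    have h1 := tri (node p s) (node p t) (node p (t + 1))
    have h2 := step t
    rw [mul_add]
    omega
  · intro l t h
    have h1 := tri (node p s) (node p (t + 1)) (node p t)
    have h2 := step t
    rw [SimpleGraph.dist_comm] at h2
    rw [mul_add]
    omega
  · intro l t t' ht h
    have h1 := tri (node p s) (node p t) (node p t')
    -- Chords are not stretched; the bound by `scale p` is generous here.
    have h2 : bigGraph.dist (node p t) (node p t') ≤ 1 :=
      lineGraph_dist_chord_le ⟨p, t, t', ht, rfl, rfl⟩
    have h3 := scale_pos p
    rw [mul_add]
    omega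

/-- A space that contains the nodes of the graph isometrically contains large cubes. -/
theorem hasLargeCubes_of_nodes {X : Type*} [PseudoMetricSpace X] (f : {u // IsNode u} → X)
    (hf : ∀ u v, dist (f u) (f v) = bigGraph.dist u.1 v.1) : HasLargeCubes X := by
  intro n
  have hmem : ∀ x, IsNode (node n ((model n).cube x)) := fun x =>
    ⟨n, _, ((model n).cube_mem x).1, ((model n).cube_mem x).2, rfl⟩
  have hpos : (1 : ℝ) ≤ scale n := by exact_mod_cast scale_pos n
  -- The mesh is `6 * n + 1` rather than `6 * n` to be positive for `n = 0`. The side length exceeds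
  -- `n * (6 * n + 1) + n`, which gives the strict separation since `scale n ≥ 1`.
  refine ⟨scale n * (6 * n + 1), sideLength n, fun x => f ⟨_, hmem x⟩, by positivity, ?_, ?_⟩
  · intro z y hz hy
    rw [dist_comm, hf]
    have h1 := dist_node_le n ((model n).cube z) ((model n).cube y)
    have h2 := Nat.mul_le_mul_left (scale n)
      (((model n).dist_cube_le z y hz hy).trans (Nat.le_succ _))
    exact_mod_cast h1.trans h2
  · intro i x y hx hy hx0 hyk
    rw [hf]
    have h1 := bigCoord_sub_le_dist n i (node n ((model n).cube x)) (node n ((model n).cube y))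
    rw [bigCoord_node, bigCoord_node, (model n).coord_cube i x (hx i),
      (model n).coord_cube i y (hy i), hx0, hyk, Nat.cast_zero, mul_zero, sub_zero] at h1
    have h2 : scale n * sideLength n ≤
        bigGraph.dist (node n ((model n).cube x)) (node n ((model n).cube y)) := by
      exact_mod_cast (le_abs_self _).trans h1
    have h3 : (scale n : ℝ) * sideLength n ≤
        bigGraph.dist (node n ((model n).cube x)) (node n ((model n).cube y)) := by
      exact_mod_cast h2
    refine lt_of_lt_of_le ?_ h3
    unfold sideLength
    push_cast
    have h4 : (0 : ℝ) ≤ n := Nat.cast_nonneg n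
    nlinarith

/-! ### The size of balls -/

/-- A walk of length at most `r` that stays beyond `start P` can use only one chord: there is at
most one chord end `e` near `v`, and after crossing to `w` the only chord end within reach is `w`,
whose chord leads back to `e`. Chords starting below `start P` end below it, and a walk going up
from there is too short to reach the next node. -/
theorem ball_subset {P r v : ℕ} (hr : 2 * r < scale P) :
    ∃ w, ∀ u, bigGraph.dist v u ≤ r →
      u ≤ start P + r ∨ (u ≤ v + r ∧ v ≤ u + r) ∨ (u ≤ w + r ∧ w ≤ u + r) := by
  have key : ∀ u, bigGraph.dist v u ≤ r → u ≤ start P + bigGraph.dist v u ∨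
      (u ≤ v + bigGraph.dist v u ∧ v ≤ u + bigGraph.dist v u) ∨
      ∃ e w, bigChord e w ∧ start P ≤ e ∧
        (e ≤ v + bigGraph.dist v u ∧ v ≤ e + bigGraph.dist v u) ∧
        (u ≤ w + bigGraph.dist v u ∧ w ≤ u + bigGraph.dist v u) := by
    refine lineGraph_dist_induction (fun _ _ => bigChord.symm)
      (fun l u => l ≤ r → u ≤ start P + l ∨ (u ≤ v + l ∧ v ≤ u + l) ∨
        ∃ e w, bigChord e w ∧ start P ≤ e ∧ (e ≤ v + l ∧ v ≤ e + l) ∧ (u ≤ w + l ∧ w ≤ u + l))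
      (by simp) ?_ ?_ ?_
    · intro l u h hl
      rcases h (by omega) with h | h | ⟨e, w, h1, h2, h3, h4⟩
      · left; omega
      · right; left; omega
      · exact Or.inr (Or.inr ⟨e, w, h1, h2, by omega, by omega⟩)
    · intro l u h hl
      rcases h (by omega) with h | h | ⟨e, w, h1, h2, h3, h4⟩
      · left; omega
      · right; left; omega
      · exact Or.inr (Or.inr ⟨e, w, h1, h2, by omega, by omega⟩)
    · intro l u u' huu h hl
      rcases lt_or_ge u (start P) with hu | hu
      · have := huu.lt_start hu
        left; omega
      rcases h (by omega) with h | h | ⟨e, w, h1, h2, h3, h4⟩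
      · have := huu.isNode.start_add_scale_le hu
        omega
      · exact Or.inr (Or.inr ⟨u, u', huu, hu, by omega, by omega⟩)
      · have hw : start P ≤ w := by
          by_contra hw
          have := h1.symm.lt_start (not_le.mp hw)
          omega
        obtain rfl := huu.isNode.eq_of_near h1.symm.isNode hu hw (by omega) (by omega)
        obtain rfl := huu.unique h1.symm
        right; left; omega
  -- The point `w` found by the invariant may depend on `u`; uniqueness of `e` near `v` makes it
  -- uniform.
  by_cases hex : ∃ e w, bigChord e w ∧ start P ≤ e ∧ (e ≤ v + r ∧ v ≤ e + r)
  · obtain ⟨e, w, hew, he, h⟩ := hex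
    refine ⟨w, fun u hu => ?_⟩
    rcases key u hu with h' | h' | ⟨e', w', h1, h2, h3, h4⟩
    · left; omega
    · right; left; omega
    · obtain rfl := hew.isNode.eq_of_near h1.isNode he h2 (by omega) (by omega)
      obtain rfl := hew.unique h1
      right; right; omega
  · refine ⟨v, fun u hu => ?_⟩
    rcases key u hu with h' | h' | ⟨e', w', h1, h2, h3, h4⟩
    · left; omega
    · right; left; omega
    · exact absurd ⟨e', w', h1, h2, by omega, by omega⟩ hex

theorem encard_ball_le {P r : ℕ} (v : ℕ) (hr : 2 * r < scale P) :
    {u | bigGraph.dist v u ≤ r}.encard ≤ (start P + 5 * r + 3 : ℕ) := by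
  obtain ⟨w, hw⟩ := ball_subset (v := v) hr
  have hsub : {u | bigGraph.dist v u ≤ r} ⊆ ((Finset.range (start P + r + 1) ∪
      (Finset.Icc (v - r) (v + r) ∪ Finset.Icc (w - r) (w + r)) : Finset ℕ) : Set ℕ) := by
    intro u hu
    have := hw u hu
    simp only [Finset.coe_union, Set.mem_union, Finset.mem_coe, Finset.mem_range, Finset.mem_Icc]
    omega
  refine (Set.encard_le_encard hsub).trans ?_
  rw [Set.encard_coe_eq_coe_finsetCard]
  have h1 := Finset.card_union_le (Finset.range (start P + r + 1))
    (Finset.Icc (v - r) (v + r) ∪ Finset.Icc (w - r) (w + r))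
  have h2 := Finset.card_union_le (Finset.Icc (v - r) (v + r)) (Finset.Icc (w - r) (w + r))
  simp only [Nat.card_Icc, Finset.card_range] at h1 h2
  exact_mod_cast (by omega)

/-- Below `start p` every integer is counted, model `p` contributes at most its size, and each of
the two far intervals, being shorter than `scale (p + 1)`, contains at most one node. -/
theorem encard_node_ball_le {p r : ℕ} (v : ℕ) (hr : 2 * r < scale (p + 1)) :
    {u | IsNode u ∧ bigGraph.dist v u ≤ r}.encard ≤ (start p + (model p).size + 2 : ℕ) := by
  obtain ⟨w, hw⟩ := ball_subset (v := v) hr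
  let A : ℕ → Set ℕ := fun c => {u | IsNode u ∧ start (p + 1) ≤ u ∧ u ≤ c + r ∧ c ≤ u + r}
  have hA : ∀ c, (A c).encard ≤ 1 := by
    intro c
    rw [Set.encard_le_one_iff]
    rintro a b ⟨ha, ha', h1, h2⟩ ⟨hb, hb', h3, h4⟩
    exact ha.eq_of_near hb ha' hb' (by omega) (by omega)
  have hsub : {u | IsNode u ∧ bigGraph.dist v u ≤ r} ⊆ ((Finset.range (start p) ∪
      (Finset.range (model p).size).image (node p) : Finset ℕ) : Set ℕ) ∪ (A v ∪ A w) := by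
    rintro u ⟨hu, hd⟩
    rcases lt_or_ge u (start (p + 1)) with h | h
    · left
      obtain ⟨q, s, hs, hs', rfl⟩ := hu
      rcases lt_or_ge (node q s) (start p) with h' | h'
      · simp [h']
      · have hq : q = p := by
          have h1 := le_of_start_le_node hs' h'
          by_contra hne
          have h2 := start_mono (show p + 1 ≤ q by omega)
          have h3 := (node_bounds hs hs').1
          omega
        subst hq
        simp only [Finset.coe_union, Finset.coe_image, Set.mem_union, Set.mem_image]
        exact Or.inr ⟨s, by simpa using hs', rfl⟩
    · right
      have h1 := hu.start_add_scale_le h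
      rcases hw u hd with h' | h' | h'
      · omega
      · exact Or.inl ⟨hu, h, h'⟩
      · exact Or.inr ⟨hu, h, h'⟩
  refine (Set.encard_le_encard hsub).trans ((Set.encard_union_le _ _).trans ?_)
  have h1 : (A v ∪ A w).encard ≤ 2 :=
    (Set.encard_union_le _ _).trans ((add_le_add (hA v) (hA w)).trans (by norm_num))
  rw [Set.encard_coe_eq_coe_finsetCard]
  have h2 := Finset.card_union_le (Finset.range (start p))
    ((Finset.range (model p).size).image (node p))
  have h3 := Finset.card_image_le (s := Finset.range (model p).size) (f := node p)
  simp only [Finset.card_range] at h2 h3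
  have h4 : (((Finset.range (start p) ∪ (Finset.range (model p).size).image (node p)).card : ℕ) :
      ℕ∞) ≤ (start p + (model p).size : ℕ) := by exact_mod_cast (by omega)
  push_cast at h4 ⊢
  exact add_le_add h4 h1

theorem graphGrowth_bigGraph_le {P : ℕ} {r : ℝ} (h0 : 0 ≤ r) (hr : 2 * ⌊r⌋₊ < scale P) :
    graphGrowth bigGraph r ≤ (start P + 5 * ⌊r⌋₊ + 3 : ℕ) := by
  refine iSup_le fun v => ?_
  simp only [← Nat.le_floor_iff h0]
  exact encard_ball_le v hr

/-- The nodes, as a subspace of the realization of the graph. -/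
def NodeSpace : Type := {q : Realization bigGraph // ∃ u, IsNode u ∧ q = vertex bigGraph u}

instance nodeSpaceMetric : MetricSpace NodeSpace :=
  letI := realizationMetricSpace bigGraph_connected
  inferInstanceAs (MetricSpace {q : Realization bigGraph // ∃ u, IsNode u ∧ q = vertex bigGraph u})

/-- A node as a point of the space of nodes. -/
def nodePoint (u : {u // IsNode u}) : NodeSpace := ⟨vertex bigGraph u.1, u.1, u.2, rfl⟩

theorem nodePoint_surjective : Function.Surjective nodePoint := by
  rintro ⟨_, u, hu, rfl⟩
  exact ⟨⟨u, hu⟩, rfl⟩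

theorem dist_nodePoint (u v : {u // IsNode u}) :
    dist (nodePoint u) (nodePoint v) = bigGraph.dist u.1 v.1 :=
  pathDist_vertex bigGraph_connected u.1 v.1

theorem metricGrowth_nodeSpace_le {p : ℕ} {r : ℝ} (h0 : 0 ≤ r)
    (hr : 2 * ⌊r⌋₊ < scale (p + 1)) (t : ℝ) :
    metricGrowth NodeSpace t r ≤ (start p + (model p).size + 2 : ℕ) := by
  refine iSup_le fun v => iSup_le fun N => iSup_le fun _ => ?_
  obtain ⟨v, rfl⟩ := nodePoint_surjective v
  have hsub : (Metric.closedBall (nodePoint v) r ∩ N) ⊆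
      nodePoint '' {u | bigGraph.dist v.1 u.1 ≤ ⌊r⌋₊} := by
    rintro q ⟨h, -⟩
    obtain ⟨u, rfl⟩ := nodePoint_surjective q
    refine ⟨u, ?_, rfl⟩
    rw [Metric.mem_closedBall, dist_comm, dist_nodePoint] at h
    exact (Nat.le_floor_iff h0).mpr h
  refine (Set.encard_le_encard hsub).trans ((Set.encard_image_le _ _).trans ?_)
  refine le_trans ?_ (encard_node_ball_le v.1 hr)
  rw [← Subtype.val_injective.encard_image]
  refine Set.encard_le_encard ?_
  rintro _ ⟨u, hu, rfl⟩
  exact ⟨u.2, hu⟩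

/-! ### Asymptotics -/

/-- Selects the model that is visible at radius `r`; the two growth estimates compare it with `scale
p ≤ 2 * r`. -/
theorem exists_scale (p₀ : ℕ) : ∀ᶠ r : ℝ in atTop, 1 ≤ r ∧ ∃ p, p₀ ≤ p ∧
    (scale p : ℝ) ≤ 2 * r ∧ 2 * ⌊r⌋₊ < scale (p + 1) := by
  filter_upwards [eventually_ge_atTop (scale p₀ : ℝ), eventually_ge_atTop 1] with r hr h1
  refine ⟨h1, ?_⟩
  have h0 : (0 : ℝ) ≤ r := by linarith
  have hex : ∃ q, 2 * ⌊r⌋₊ < scale q :=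
    ⟨2 * ⌊r⌋₊, by have := base_le_scale (2 * ⌊r⌋₊); omega⟩
  classical
  have hfind := Nat.find_spec hex
  have hmin := fun m => Nat.find_min hex (m := m)
  generalize Nat.find hex = q at hfind hmin
  have hfl : scale p₀ ≤ ⌊r⌋₊ := Nat.le_floor hr
  have hq : p₀ < q := by
    by_contra h
    have := scale_mono (not_lt.mp h)
    omega
  obtain ⟨p, rfl⟩ : ∃ p, q = p + 1 := ⟨q - 1, by omega⟩
  refine ⟨p, by omega, ?_, hfind⟩
  have h2 := hmin p (by omega)
  have h3 : (scale p : ℝ) ≤ 2 * (⌊r⌋₊ : ℝ) := by exact_mod_cast not_lt.mp h2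
  have h4 := Nat.floor_le h0
  linarith

theorem tendsto_div_ofReal {γ : ℝ → ℕ∞} {g : ℝ → ℝ}
    (h : ∀ δ : ℝ, 0 < δ → ∀ᶠ r in atTop, 0 < g r ∧ ∃ N : ℕ, γ r ≤ N ∧ (N : ℝ) ≤ δ * g r) :
    Tendsto (fun r => (γ r : ℝ≥0∞) / ENNReal.ofReal (g r)) atTop (𝓝 0) := by
  rw [ENNReal.tendsto_nhds_zero]
  intro ε hε
  obtain ⟨δ, hδ, hδε⟩ : ∃ δ : ℝ, 0 < δ ∧ ENNReal.ofReal δ ≤ ε := by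
    obtain ⟨δ, h1, h2⟩ := ENNReal.lt_iff_exists_nnreal_btwn.mp hε
    exact ⟨δ, by exact_mod_cast h1, by rw [ENNReal.ofReal_coe_nnreal]; exact h2.le⟩
  filter_upwards [h δ hδ] with r ⟨hg, N, hN, hN'⟩
  refine le_trans ?_ hδε
  refine ENNReal.div_le_of_le_mul ?_
  rw [← ENNReal.ofReal_mul hδ.le]
  have h1 : (γ r : ℝ≥0∞) ≤ ((N : ℕ∞) : ℝ≥0∞) := ENat.toENNReal_mono hN
  rw [ENat.toENNReal_coe, ← ENNReal.ofReal_natCast] at h1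
  exact h1.trans (ENNReal.ofReal_le_ofReal hN')

theorem tendsto_metricGrowth_nodeSpace :
    Tendsto (fun r : ℝ => (metricGrowth NodeSpace 1 r : ℝ≥0∞) / ENNReal.ofReal r)
      atTop (𝓝 0) := by
  refine tendsto_div_ofReal fun δ hδ => ?_
  obtain ⟨p₀, hp₀⟩ := exists_nat_ge (2 / δ)
  filter_upwards [exists_scale p₀] with r ⟨h1, p, hp, hs, hs'⟩
  refine ⟨by linarith, _, metricGrowth_nodeSpace_le (by linarith) hs' 1, ?_⟩
  -- Sublinearity uses only that `scale p` is at least the square of its base.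
  have h2 : (start p + (model p).size + 2) * (p + 2) ≤ scale p := by
    calc (start p + (model p).size + 2) * (p + 2)
        ≤ (start p + (model p).size + p + 2) * (start p + (model p).size + p + 2) :=
          Nat.mul_le_mul (by omega) (by omega)
      _ = (start p + (model p).size + p + 2) ^ 2 := (sq _).symm
      _ ≤ scale p := Nat.pow_le_pow_right (by omega) (by omega)
  have h3 : ((start p + (model p).size + 2 : ℕ) : ℝ) * (p + 2) ≤ 2 * r := by
    refine le_trans ?_ hs
    exact_mod_cast h2
  have h4 : 2 / δ ≤ p + 2 := by
    have : (p₀ : ℝ) ≤ p := by exact_mod_cast hp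
    linarith
  have h5 : 2 ≤ (p + 2) * δ := (div_le_iff₀ hδ).mp h4
  have h6 : (0 : ℝ) < p + 2 := by positivity
  have h7 : (0 : ℝ) ≤ r * ((p + 2) * δ - 2) := mul_nonneg (by linarith) (by linarith)
  refine le_of_mul_le_mul_right (h3.trans ?_) h6
  linarith

/-- With `scale p = b ^ (p + 2)`, all of model `p` ends before `scale p * b`, and `b ≤ scale p ^ ε`
once `(p + 2) * ε ≥ 1`. This is why the exponent in `scale` grows with `p`. -/
theorem start_succ_le_rpow {p : ℕ} {ε r : ℝ} (h1 : 1 ≤ r) (hs : (scale p : ℝ) ≤ 2 * r)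
    (hp : 1 ≤ (p + 2) * ε) : (start (p + 1) : ℝ) ≤ 2 * r * (2 * r) ^ ε := by
  set b : ℕ := start p + (model p).size + p + 2 with hb
  have hb1 : (1 : ℝ) ≤ b := by exact_mod_cast (by omega : 1 ≤ b)
  have hscale : (scale p : ℝ) = (b : ℝ) ^ (p + 2) := by rw [scale]; push_cast [hb]; rfl
  have h2 : start (p + 1) ≤ scale p * b := by
    rw [start_succ, hb]
    have := scale_pos p
    calc start p + scale p * (model p).size
        ≤ scale p * start p + scale p * (model p).size :=
          Nat.add_le_add_right (Nat.le_mul_of_pos_left _ this) _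
      _ = scale p * (start p + (model p).size) := (mul_add _ _ _).symm
      _ ≤ _ := Nat.mul_le_mul_left _ (by omega)
  have hε : 0 ≤ ε := by
    by_contra h
    have : (p + 2 : ℝ) * ε ≤ 0 := mul_nonpos_of_nonneg_of_nonpos (by positivity) (by linarith)
    linarith
  have h3 : (b : ℝ) ≤ (2 * r) ^ ε := by
    calc (b : ℝ) = (b : ℝ) ^ (1 : ℝ) := (Real.rpow_one _).symm
      _ ≤ (b : ℝ) ^ (((p + 2 : ℕ) : ℝ) * ε) :=
          Real.rpow_le_rpow_of_exponent_le hb1 (by push_cast; exact hp)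
      _ = (scale p : ℝ) ^ ε := by rw [Real.rpow_mul (by linarith), Real.rpow_natCast, hscale]
      _ ≤ (2 * r) ^ ε := Real.rpow_le_rpow (Nat.cast_nonneg _) hs hε
  have h4 : (start (p + 1) : ℝ) ≤ scale p * b := by exact_mod_cast h2
  exact h4.trans (mul_le_mul hs h3 (by linarith) (by linarith))

theorem tendsto_graphGrowth_bigGraph {ε : ℝ} (hε : 0 < ε) :
    Tendsto (fun r : ℝ => (graphGrowth bigGraph r : ℝ≥0∞) / ENNReal.ofReal (r ^ (1 + ε)))
      atTop (𝓝 0) := by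
  refine tendsto_div_ofReal fun δ hδ => ?_
  -- Half of `ε` bounds the growth; the other half supplies the factor `r ^ (ε / 2)` that absorbs
  -- the constants and `δ`.
  obtain ⟨p₀, hp₀⟩ := exists_nat_ge (1 / (ε / 2))
  have hlarge := (tendsto_rpow_atTop (half_pos hε)).eventually_ge_atTop
    (10 * (2 : ℝ) ^ (ε / 2) / δ)
  filter_upwards [exists_scale p₀, hlarge] with r ⟨h1, p, hp, hs, hs'⟩ hl
  have h0 : 0 < r := by linarith
  refine ⟨by positivity, _, graphGrowth_bigGraph_le h0.le hs', ?_⟩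
  have hp2 : 1 ≤ ((p : ℝ) + 2) * (ε / 2) := by
    rw [← div_le_iff₀ (half_pos hε)]
    have : (p₀ : ℝ) ≤ p := by exact_mod_cast hp
    linarith
  have h2 := start_succ_le_rpow h1 hs hp2
  have h3 : (1 : ℝ) ≤ (2 * r) ^ (ε / 2) := Real.one_le_rpow (by linarith) (by positivity)
  have h4 := Nat.floor_le h0.le
  have h5 : r * 1 ≤ r * (2 * r) ^ (ε / 2) := mul_le_mul_of_nonneg_left h3 h0.le
  rw [div_le_iff₀ hδ] at hl
  have h6 : (2 * r) ^ (ε / 2) = 2 ^ (ε / 2) * r ^ (ε / 2) :=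
    Real.mul_rpow (by norm_num) h0.le
  have h7 : r ^ (1 + ε) = r * (r ^ (ε / 2) * r ^ (ε / 2)) := by
    rw [← Real.rpow_add h0, add_halves, Real.rpow_add h0, Real.rpow_one]
  push_cast
  have h8 : (start (p + 1) : ℝ) + 5 * ⌊r⌋₊ + 3 ≤ 10 * (r * (2 * r) ^ (ε / 2)) := by linarith
  refine h8.trans ?_
  rw [h6, h7]
  have h9 : 0 ≤ r * r ^ (ε / 2) := by positivity
  calc 10 * (r * (2 ^ (ε / 2) * r ^ (ε / 2))) = r * r ^ (ε / 2) * (10 * 2 ^ (ε / 2)) := by ring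
    _ ≤ r * r ^ (ε / 2) * (r ^ (ε / 2) * δ) := mul_le_mul_of_nonneg_left hl h9
    _ = δ * (r * (r ^ (ε / 2) * r ^ (ε / 2))) := by ring

theorem graphAsymptoticANDim_bigGraph : graphAsymptoticANDim bigGraph_connected = ⊤ := by
  let _ := realizationMetricSpace bigGraph_connected
  exact asymptoticANDim_eq_top (hasLargeCubes_of_nodes (fun u => vertex bigGraph u.1)
    fun u v => pathDist_vertex bigGraph_connected u.1 v.1)

end CoarseGeometry

end

theorem theorem3 :
    (∃ (X : Type) (_ : MetricSpace X),
      Tendsto (fun r : ℝ => (CoarseGeometry.metricGrowth X 1 r : ℝ≥0∞) / ENNReal.ofReal r)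
        atTop (𝓝 0) ∧
      CoarseGeometry.asymptoticANDim X = ⊤) ∧
    (∃ (V : Type) (G : SimpleGraph V) (hG : G.Connected),
      (∀ ε : ℝ, 0 < ε →
        Tendsto (fun r : ℝ =>
          (CoarseGeometry.graphGrowth G r : ℝ≥0∞) / ENNReal.ofReal (r ^ (1 + ε)))
          atTop (𝓝 0)) ∧
      CoarseGeometry.graphAsymptoticANDim hG = ⊤) :=
  ⟨⟨CoarseGeometry.NodeSpace, CoarseGeometry.nodeSpaceMetric,
      CoarseGeometry.tendsto_metricGrowth_nodeSpace,
      CoarseGeometry.asymptoticANDim_eq_top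
        (CoarseGeometry.hasLargeCubes_of_nodes _ CoarseGeometry.dist_nodePoint)⟩,
    ⟨ℕ, CoarseGeometry.bigGraph, CoarseGeometry.bigGraph_connected,
      fun _ => CoarseGeometry.tendsto_graphGrowth_bigGraph,
      CoarseGeometry.graphAsymptoticANDim_bigGraph⟩⟩
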